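/- Let $(\Omega_1,\mathcal A_1,P_1)$ and $(\Omega_2,\mathcal A_2,P_2)$ be probability spaces, and let $p\in\mathbb N$. For each $n$ let $N=N_n:\Omega_1\to\mathbb N_0$ be a random variable, non-decreasing in $n$, with $N\to\infty$ in $P_1$-probability as $n\to\infty$, and let $Z_{n;l}:\Omega_1\to\mathbb R^p$, $l=1,\dots,N$, be a triangular array of random vectors with the random number $N$ of entries in row $n$. Let $G_{n;l}:\Omega_2\to\mathbb R$, $l\in\mathbb N$, be random variables such that, for each $n$, the $G_{n;l}$, $l\in\mathbb N$, are independent, and all $G_{n;l}$ have the same distribution, which depends neither on $l$ nor on $n$, with $E(G_{n;1})=0$ and $\operatorname{var}(G_{n;1})=1$. All variables are regarded as defined on the product space $(\Omega_1\times\Omega_2,\mathcal A_1\otimes\mathcal A_2,P_1\otimes P_2)$, the $N$ and $Z_{n;l}$ depending only on the first coordinate and the $G_{n;l}$ only on the second, so that $(N,Z_{n;l}:l\le N)$ and $(G_{n;l})_{l\in\mathbb N}$ are independent. Suppose that, as $n\to\infty$, $$\max_{1\le l\le N}\|Z_{n;l}\|\xrightarrow{P}0\qquad\text{and}\qquad\sum_{l=1}^{N}Z_{n;l}Z_{n;l}'\xrightarrow{P}\Gamma,$$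 where $\|\cdot\|$ is the Euclidean norm, the maximum over the empty set is $0$, and $\Gamma$ is a (deterministic) positive definite covariance matrix. Then the conditional law of $\sum_{l=1}^{N}G_{n;l}Z_{n;l}$ given $(N,Z_{n;l}:l\le N)$ converges weakly to the $p$-dimensional normal distribution in probability: $$\mathcal L\Big(\sum_{l=1}^{N}G_{n;l}Z_{n;l}\ \Big|\ N,\,Z_{n;l}:l\le N\Big)\xrightarrow{d}N(0,\Gamma)\quad\text{in probability},$$ that is, for every bounded continuous $f:\mathbb R^p\to\mathbb R$, $E\big[f\big(\sum_{l=1}^{N}G_{n;l}Z_{n;l}\big)\,\big|\,N,\,Z_{n;l}:l\le N\big]\to\int f\,dN(0,\Gamma)$ in probability. -/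

import Mathlib

open Filter Topology MeasureTheory ProbabilityTheory
open scoped BoundedContinuousFunction NNReal

noncomputable section

namespace WildBootstrap

variable {Ω Ω₁ Ω₂ : Type*} {p : ℕ}

/-- The data on which one conditions at stage `n`: the number `N n` of summands together with the
vectors `Z n l` for `l < N n`. The values `Z n l` with `l ≥ N n` are not part of the array, so they
are blanked out (the map records nothing about them). The rows are indexed by `l = 0, …, N n - 1`
instead of `l = 1, …, N n`. -/
def data (N : ℕ → Ω₁ → ℕ) (Z : ℕ → ℕ → Ω₁ → EuclideanSpace ℝ (Fin p)) (n : ℕ) (ω : Ω₁) :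
    ℕ × (ℕ → EuclideanSpace ℝ (Fin p)) :=
  (N n ω, fun l => if l < N n ω then Z n l ω else 0)

/-- The multiplier sum `∑_l G_{n;l} Z_{n;l}` over the `N n` summands of row `n`, as a random vector
on the product space; data depend on the first, multipliers on the second coordinate. -/
def multiplierSum (N : ℕ → Ω₁ → ℕ) (Z : ℕ → ℕ → Ω₁ → EuclideanSpace ℝ (Fin p))
    (G : ℕ → ℕ → Ω₂ → ℝ) (n : ℕ) (ω : Ω₁ × Ω₂) : EuclideanSpace ℝ (Fin p) :=
  ∑ l ∈ Finset.range (N n ω.1), G n l ω.2 • Z n l ω.1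

/-- The regular conditional distribution of the multiplier sum given the data of row `n`, under the
product measure, as a random measure on the product space. -/
def condLaw [MeasurableSpace Ω₁] [MeasurableSpace Ω₂]
    (P₁ : Measure Ω₁) (P₂ : Measure Ω₂) [IsProbabilityMeasure P₁] [IsProbabilityMeasure P₂]
    (N : ℕ → Ω₁ → ℕ) (Z : ℕ → ℕ → Ω₁ → EuclideanSpace ℝ (Fin p))
    (G : ℕ → ℕ → Ω₂ → ℝ) (n : ℕ) (ω : Ω₁ × Ω₂) : Measure (EuclideanSpace ℝ (Fin p)) :=
  condDistrib (multiplierSum N Z G n) (fun ω : Ω₁ × Ω₂ => data N Z n ω.1) (P₁.prod P₂)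
    (data N Z n ω.1)

/-- Weak convergence in probability of random laws `κ n` to a deterministic law `ν`: the integral
of every bounded continuous function converges in probability. -/
def TendstoWeaklyInProbability [MeasurableSpace Ω] {E : Type*} [TopologicalSpace E]
    [MeasurableSpace E] (P : Measure Ω) (κ : ℕ → Ω → Measure E) (ν : Measure E) : Prop :=
  ∀ f : E →ᵇ ℝ, TendstoInMeasure P (fun n ω => ∫ x, f x ∂(κ n ω)) atTop (fun _ => ∫ x, f x ∂ν)

end WildBootstrap

end

/-!
Since data and multipliers live on different factors of a product space, the conditional law given
the data is almost surely the law, under `P₂`, of `∑ G_l z_l` with the data frozen at deterministic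
values `z_l` (`condLaw_ae_eq_map`).

For deterministic weights this is a central limit theorem (`tendsto_integral_sum_smul`). The
characteristic function of `∑ G_l z_l` at `t` is `∏ φ ⟨z_l, t⟩`, with `φ` the characteristic function
of one multiplier, and `φ a = exp (-a² / 2) + o(a²)` as the multipliers are centred with variance
one. If the `z_l` are uniformly small and `∑ z_l z_l'` is close to `Γ`, the product is therefore close
to `exp (-∑ ⟨z_l, t⟩² / 2)`, hence to the characteristic function of `N(0, Γ)`, and Lévy's continuity
theorem applies.

A proof by contradiction makes this uniform (`exists_forall_abs_integral_sum_smul_sub_lt`): for each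
bounded continuous `f` and `ε > 0` there is `δ > 0` such that `max ‖z_l‖ < δ` and
`|∑ z_l z_l' - Γ| < δ` entrywise force the integral of `f` against the law of `∑ G_l z_l` to be within
`ε` of its Gaussian integral. So, up to a null set, the event that the conditional integral is at
least `ε` away from its limit is contained in the events that `max ‖Z_l‖ ≥ δ` or that some entry of
`∑ Z_l Z_l'` is at least `δ` away from that of `Γ`, whose probabilities tend to zero by hypothesis.
-/

namespace WildBootstrap

/-! ### Products of characteristic functions with small arguments -/

theorem norm_prod_sub_prod_le_sum {ι : Type*} (s : Finset ι) (f g : ι → ℂ)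
    (hf : ∀ i ∈ s, ‖f i‖ ≤ 1) (hg : ∀ i ∈ s, ‖g i‖ ≤ 1) :
    ‖∏ i ∈ s, f i - ∏ i ∈ s, g i‖ ≤ ∑ i ∈ s, ‖f i - g i‖ := by
  classical
  induction s using Finset.induction_on with
  | empty => simp
  | insert a s ha ih =>
    rw [Finset.prod_insert ha, Finset.prod_insert ha, Finset.sum_insert ha]
    have hs := ih (fun i hi => hf i (Finset.mem_insert_of_mem hi))
      (fun i hi => hg i (Finset.mem_insert_of_mem hi))
    have hfa := hf a (Finset.mem_insert_self a s)
    have hgs : ‖∏ i ∈ s, g i‖ ≤ 1 := by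
      rw [norm_prod]
      exact Finset.prod_le_one (fun _ _ => norm_nonneg _)
        fun i hi => hg i (Finset.mem_insert_of_mem hi)
    calc ‖f a * ∏ i ∈ s, f i - g a * ∏ i ∈ s, g i‖
        = ‖f a * (∏ i ∈ s, f i - ∏ i ∈ s, g i) + (f a - g a) * ∏ i ∈ s, g i‖ := by ring_nf
      _ ≤ ‖f a‖ * ‖∏ i ∈ s, f i - ∏ i ∈ s, g i‖ + ‖f a - g a‖ * ‖∏ i ∈ s, g i‖ := by
        grw [norm_add_le, norm_mul, norm_mul]
      _ ≤ 1 * (∑ i ∈ s, ‖f i - g i‖) + ‖f a - g a‖ * 1 := by gcongr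
      _ = ‖f a - g a‖ + ∑ i ∈ s, ‖f i - g i‖ := by ring

/-- A second order expansion `1 - a² / 2` may be replaced by the Gaussian characteristic function
`exp (-a² / 2)`, whose modulus, unlike that of `1 - a² / 2`, is at most one everywhere. -/
theorem isLittleO_sub_exp_neg_sq_div_two {ψ : ℝ → ℂ}
    (h : (fun a : ℝ => ψ a - (1 - (a : ℂ) ^ 2 / 2)) =o[𝓝 0] fun a => a ^ 2) :
    (fun a : ℝ => ψ a - Complex.exp (-(a : ℂ) ^ 2 / 2)) =o[𝓝 0] fun a => a ^ 2 := by
  have hd : HasDerivAt Complex.exp 1 0 := by simpa using Complex.hasDerivAt_exp 0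
  have ht : Tendsto (fun a : ℝ => -(a : ℂ) ^ 2 / 2) (𝓝 0) (𝓝 0) := by
    have : Continuous fun a : ℝ => -(a : ℂ) ^ 2 / 2 := by fun_prop
    simpa using this.tendsto 0
  have he := (hasDerivAt_iff_isLittleO.1 hd).comp_tendsto ht
  have he' : (fun a : ℝ => Complex.exp (-(a : ℂ) ^ 2 / 2) - (1 - (a : ℂ) ^ 2 / 2))
      =o[𝓝 0] fun a => a ^ 2 := by
    refine (he.congr_left ?_).trans_isBigO ?_
    · intro a
      simp only [Function.comp_apply, Complex.exp_zero, sub_zero, smul_eq_mul, mul_one]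
      ring
    · refine Asymptotics.IsBigO.of_bound 1 (Eventually.of_forall fun a => ?_)
      simp only [Function.comp_apply, sub_zero, norm_div, norm_neg, norm_pow, Complex.norm_real,
        Complex.norm_ofNat, one_mul]
      linarith [sq_nonneg ‖a‖]
  refine (h.sub he').congr_left fun a => ?_
  ring

/-- Lindeberg's comparison for characteristic functions: replacing every factor `ψ (a_l)` by
`exp (-a_l² / 2)` costs at most `∑ o(a_l²)`, and this is small because the `a_l` are uniformly small
while `∑ a_l²` stays bounded. -/
theorem tendsto_prod_exp_neg_div_two {κ : Type*} {F : Filter κ} {ψ : ℝ → ℂ}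
    (hψ : (fun a : ℝ => ψ a - (1 - (a : ℂ) ^ 2 / 2)) =o[𝓝 0] fun a => a ^ 2)
    (hψ1 : ∀ a, ‖ψ a‖ ≤ 1) {m : κ → ℕ} {a : κ → ℕ → ℝ} {s : ℝ}
    (ha : ∀ δ > 0, ∀ᶠ k in F, ∀ l < m k, |a k l| < δ)
    (hs : Tendsto (fun k => ∑ l ∈ Finset.range (m k), a k l ^ 2) F (𝓝 s)) :
    Tendsto (fun k => ∏ l ∈ Finset.range (m k), ψ (a k l)) F
      (𝓝 (Complex.exp (-(s : ℂ) / 2))) := by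
  have hexp : Tendsto (fun k => ∏ l ∈ Finset.range (m k), Complex.exp (-(a k l : ℂ) ^ 2 / 2)) F
      (𝓝 (Complex.exp (-(s : ℂ) / 2))) := by
    have hc : Continuous fun x : ℝ => Complex.exp (-(x : ℂ) / 2) := by fun_prop
    refine ((hc.tendsto s).comp hs).congr fun k => ?_
    rw [← Complex.exp_sum, Function.comp_apply, ← Finset.sum_div, Finset.sum_neg_distrib]
    push_cast
    rfl
  suffices hd : Tendsto (fun k => ∏ l ∈ Finset.range (m k), ψ (a k l) -
      ∏ l ∈ Finset.range (m k), Complex.exp (-(a k l : ℂ) ^ 2 / 2)) F (𝓝 0) by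
    simpa using hd.add hexp
  rw [Metric.tendsto_nhds]
  intro ε hε
  have hs0 : 0 < |s| + 1 := by positivity
  -- the sums of squares are eventually below `|s| + 1`, so the total error is below `c * (|s| + 1)`
  set c := ε / 2 / (|s| + 1) with hc
  have hc0 : 0 < c := by positivity
  obtain ⟨δ, hδ, hδc⟩ := Metric.eventually_nhds_iff.1
    ((isLittleO_sub_exp_neg_sq_div_two hψ).bound hc0)
  filter_upwards [ha δ hδ, hs.eventually_lt_const (lt_of_le_of_lt (le_abs_self s) (lt_add_one _))]
    with k hk hks
  rw [dist_zero_right]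
  calc _ ≤ ∑ l ∈ Finset.range (m k), ‖ψ (a k l) - Complex.exp (-(a k l : ℂ) ^ 2 / 2)‖ := by
        refine norm_prod_sub_prod_le_sum _ _ _ (fun _ _ => hψ1 _) fun l _ => ?_
        rw [Complex.norm_exp, Real.exp_le_one_iff]
        have : (-(a k l : ℂ) ^ 2 / 2).re = -(a k l) ^ 2 / 2 := by
          rw [← Complex.ofReal_pow, ← Complex.ofReal_neg]
          exact Complex.div_ofNat_re _ 2
        rw [this]
        linarith [sq_nonneg (a k l)]
    _ ≤ ∑ l ∈ Finset.range (m k), c * a k l ^ 2 := by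
        refine Finset.sum_le_sum fun l hl => ?_
        have := hδc (y := a k l) (by simpa using hk l (Finset.mem_range.1 hl))
        simpa using this
    _ = c * ∑ l ∈ Finset.range (m k), a k l ^ 2 := by rw [Finset.mul_sum]
    _ ≤ c * (|s| + 1) := by gcongr
    _ = ε / 2 := by rw [hc]; field_simp
    _ < ε := by linarith

/-! ### The central limit theorem for deterministic coefficients -/

theorem charFun_map_sum_smul {Ω E : Type*} [MeasurableSpace Ω] {P : Measure Ω}
    [NormedAddCommGroup E] [InnerProductSpace ℝ E] [MeasurableSpace E] [BorelSpace E]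
    [SecondCountableTopology E]
    {X : ℕ → Ω → ℝ} (hX : ∀ l, Measurable (X l)) (hind : iIndepFun X P) {μ : Measure ℝ}
    (hlaw : ∀ l, P.map (X l) = μ) (m : ℕ) (z : ℕ → E) (t : E) :
    charFun (P.map fun ω => ∑ l ∈ Finset.range m, X l ω • z l) t =
      ∏ l ∈ Finset.range m, charFun μ (inner ℝ (z l) t) := by
  have hi : iIndepFun (fun l ω => X l ω • z l) P :=
    hind.comp (fun l x => x • z l) fun l => by fun_prop
  have hm : ∀ l, Measurable fun ω => X l ω • z l := fun l => by fun_prop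
  rw [(hi.restrict _).charFun_map_fun_finsetSum_eq_prod fun l _ => (hm l).aemeasurable,
    Finset.prod_apply]
  refine Finset.prod_congr rfl fun l _ => ?_
  rw [← hlaw l, charFun_apply, charFun_apply, integral_map (hm l).aemeasurable (by fun_prop),
    integral_map (hX l).aemeasurable (by fun_prop)]
  simp [real_inner_smul_left, mul_comm, inner]

/-- The quadratic form in `t` of the matrix `∑ z_l z_l'`, as a sum of squares: this turns entrywise
convergence of that matrix into convergence of the exponent of the characteristic function. -/
theorem sum_inner_sq_eq {p : ℕ} (m : ℕ) (z : ℕ → EuclideanSpace ℝ (Fin p))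
    (t : EuclideanSpace ℝ (Fin p)) :
    ∑ l ∈ Finset.range m, (inner ℝ (z l) t) ^ 2 =
      ∑ i, ∑ j, t i * (∑ l ∈ Finset.range m, Matrix.vecMulVec (z l) (z l)) i j * t j := by
  have h : ∀ i j, t i * (∑ l ∈ Finset.range m, Matrix.vecMulVec (z l) (z l)) i j * t j =
      ∑ l ∈ Finset.range m, (t i * z l i) * (t j * z l j) := fun i j => by
    rw [Matrix.sum_apply, Finset.mul_sum, Finset.sum_mul]
    exact Finset.sum_congr rfl fun l _ => by rw [Matrix.vecMulVec_apply]; ring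
  simp_rw [h]
  rw [Finset.sum_congr rfl fun i _ => Finset.sum_comm, Finset.sum_comm]
  refine Finset.sum_congr rfl fun l _ => ?_
  rw [sq, PiLp.inner_apply, Finset.sum_mul_sum]
  simp

/-- Multivariate central limit theorem for weighted sums of i.i.d. variables with deterministic
vector weights `z k l`. The variables may change with the row `k`; only their common law is fixed. -/
theorem tendsto_integral_sum_smul {Ω : Type*} [MeasurableSpace Ω] {P : Measure Ω}
    [IsProbabilityMeasure P] {p : ℕ} {X : ℕ → ℕ → Ω → ℝ} {Γ : Matrix (Fin p) (Fin p) ℝ}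
    (hX : ∀ k l, Measurable (X k l)) (hind : ∀ k, iIndepFun (X k) P) {Y : Ω → ℝ}
    (hY : AEMeasurable Y P) (hY0 : P[Y] = 0) (hY1 : P[Y ^ 2] = 1)
    (hlaw : ∀ k l, P.map (X k l) = P.map Y) (hΓ : Γ.PosSemidef)
    {m : ℕ → ℕ} {z : ℕ → ℕ → EuclideanSpace ℝ (Fin p)}
    (hmax : ∀ δ > 0, ∀ᶠ k in atTop, ∀ l < m k, ‖z k l‖ < δ)
    (hcov : ∀ i j, Tendsto
      (fun k => (∑ l ∈ Finset.range (m k), Matrix.vecMulVec (z k l) (z k l)) i j) atTop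
      (𝓝 (Γ i j)))
    (f : EuclideanSpace ℝ (Fin p) →ᵇ ℝ) :
    Tendsto (fun k => ∫ ω, f (∑ l ∈ Finset.range (m k), X k l ω • z k l) ∂P) atTop
      (𝓝 (∫ x, f x ∂(multivariateGaussian 0 Γ))) := by
  have hS : ∀ k, Measurable fun ω => ∑ l ∈ Finset.range (m k), X k l ω • z k l :=
    fun k => by fun_prop
  have hprob : ∀ k, IsProbabilityMeasure
      (P.map fun ω => ∑ l ∈ Finset.range (m k), X k l ω • z k l) :=
    fun k => Measure.isProbabilityMeasure_map (hS k).aemeasurable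
  have : IsProbabilityMeasure (P.map Y) := Measure.isProbabilityMeasure_map hY
  let μ : ℕ → ProbabilityMeasure (EuclideanSpace ℝ (Fin p)) := fun k => ⟨_, hprob k⟩
  let ν : ProbabilityMeasure (EuclideanSpace ℝ (Fin p)) := ⟨multivariateGaussian 0 Γ, inferInstance⟩
  have hweak : Tendsto μ atTop (𝓝 ν) := by
    refine ProbabilityMeasure.tendsto_of_tendsto_charFun fun t => ?_
    have hν : charFun (ν : Measure (EuclideanSpace ℝ (Fin p))) t =
        Complex.exp (-((∑ i, ∑ j, t i * Γ i j * t j : ℝ) : ℂ) / 2) := by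
      change charFun (multivariateGaussian 0 Γ) t = _
      rw [charFun_multivariateGaussian hΓ]
      congr 1
      have : (t : Fin p → ℝ) ⬝ᵥ Γ.mulVec t = ∑ i, ∑ j, t i * Γ i j * t j := by
        simp only [dotProduct, Matrix.mulVec, Finset.mul_sum, mul_assoc]
      rw [this]
      simp
      ring
    rw [hν]
    have hμ : ∀ k, charFun (μ k : Measure (EuclideanSpace ℝ (Fin p))) t =
        ∏ l ∈ Finset.range (m k), charFun (P.map Y) (inner ℝ (z k l) t) := fun k =>
      charFun_map_sum_smul (hX k) (hind k) (hlaw k) (m k) (z k) t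
    simp_rw [hμ]
    refine tendsto_prod_exp_neg_div_two (taylor_charFun_two hY hY0 hY1)
      (fun a => norm_charFun_le_one a) (fun δ hδ => ?_) ?_
    · have ht : 0 < ‖t‖ + 1 := by positivity
      filter_upwards [hmax (δ / (‖t‖ + 1)) (by positivity)] with k hk l hl
      calc |inner ℝ (z k l) t| ≤ ‖z k l‖ * ‖t‖ := abs_real_inner_le_norm _ _
        _ ≤ ‖z k l‖ * (‖t‖ + 1) := by gcongr; linarith
        _ < δ := (lt_div_iff₀ ht).1 (hk l hl)
    · simp_rw [sum_inner_sq_eq]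
      exact tendsto_finsetSum _ fun i _ => tendsto_finsetSum _ fun j _ =>
        ((hcov i j).const_mul _).mul_const _
  refine (ProbabilityMeasure.tendsto_iff_forall_integral_tendsto.1 hweak f).congr fun k => ?_
  exact integral_map (hS k).aemeasurable f.continuous.aestronglyMeasurable

/-- Uniform form of `tendsto_integral_sum_smul`: the closeness to the Gaussian integral is
controlled by the size of the weights and of the error in their covariance sum only, uniformly in
the row `n`, the number `m` of weights and the weights themselves. -/
theorem exists_forall_abs_integral_sum_smul_sub_lt {Ω : Type*} [MeasurableSpace Ω] {P : Measure Ω}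
    [IsProbabilityMeasure P] {p : ℕ} {X : ℕ → ℕ → Ω → ℝ} {Γ : Matrix (Fin p) (Fin p) ℝ}
    (hX : ∀ k l, Measurable (X k l)) (hind : ∀ k, iIndepFun (X k) P) {Y : Ω → ℝ}
    (hY : AEMeasurable Y P) (hY0 : P[Y] = 0) (hY1 : P[Y ^ 2] = 1)
    (hlaw : ∀ k l, P.map (X k l) = P.map Y) (hΓ : Γ.PosSemidef)
    (f : EuclideanSpace ℝ (Fin p) →ᵇ ℝ) {ε : ℝ} (hε : 0 < ε) :
    ∃ δ > 0, ∀ (n m : ℕ) (z : ℕ → EuclideanSpace ℝ (Fin p)), (∀ l < m, ‖z l‖ < δ) →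
      (∀ i j, |(∑ l ∈ Finset.range m, Matrix.vecMulVec (z l) (z l)) i j - Γ i j| < δ) →
      |∫ ω, f (∑ l ∈ Finset.range m, X n l ω • z l) ∂P
        - ∫ x, f x ∂(multivariateGaussian 0 Γ)| < ε := by
  by_contra! h
  choose n m z hz hcov hbad using fun k : ℕ => h (1 / ((k : ℝ) + 1)) (by positivity)
  have hlim : Tendsto (fun k : ℕ => 1 / ((k : ℝ) + 1)) atTop (𝓝 0) :=
    tendsto_one_div_add_atTop_nhds_zero_nat
  have ht := tendsto_integral_sum_smul (fun k l => hX (n k) l) (fun k => hind (n k)) hY hY0 hY1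
    (fun k l => hlaw (n k) l) hΓ (m := m) (z := z)
    (fun δ hδ => by
      filter_upwards [hlim.eventually_lt_const hδ] with k hk l hl
      exact (hz k l hl).trans hk)
    (fun i j => tendsto_iff_norm_sub_tendsto_zero.2 <|
      squeeze_zero (fun _ => norm_nonneg _) (fun k => (hcov k i j).le) hlim) f
  obtain ⟨k, hk⟩ := (Metric.tendsto_nhds.1 ht ε hε).exists
  exact absurd hk (not_lt.2 (hbad k))

/-! ### The conditional law given the data -/

/-- On a product of probability spaces, conditioning a function of `D ω.1` and `ω.2` on `D ω.1`
amounts to freezing the first argument and integrating out the second. -/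
theorem condDistrib_prod_ae_eq_map {Ω₁ Ω₂ β E : Type*} [MeasurableSpace Ω₁] [MeasurableSpace Ω₂]
    [MeasurableSpace β] [MeasurableSpace E] [StandardBorelSpace E] [Nonempty E]
    (P₁ : Measure Ω₁) (P₂ : Measure Ω₂) [IsProbabilityMeasure P₁] [IsProbabilityMeasure P₂]
    {D : Ω₁ → β} (hD : Measurable D) {S : β × Ω₂ → E} (hS : Measurable S) :
    ∀ᵐ ω ∂(P₁.prod P₂),
      condDistrib (fun ω : Ω₁ × Ω₂ => S (D ω.1, ω.2)) (fun ω => D ω.1) (P₁.prod P₂) (D ω.1) =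
        P₂.map fun ω₂ => S (D ω.1, ω₂) := by
  let κ : Kernel β E := (Kernel.id ×ₖ Kernel.const β P₂).map S
  have hκ : ∀ b, κ b = P₂.map fun ω₂ => S (b, ω₂) := fun b => by
    rw [Kernel.map_apply _ hS, Kernel.prod_apply, Kernel.id_apply, Kernel.const_apply,
      Measure.dirac_prod, Measure.map_map hS (by fun_prop)]
    rfl
  have : IsMarkovKernel κ := Kernel.IsMarkovKernel.map _ hS
  have hD' : Measurable fun ω : Ω₁ × Ω₂ => D ω.1 := by fun_prop
  have hS' : Measurable fun ω : Ω₁ × Ω₂ => S (D ω.1, ω.2) := by fun_prop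
  have key := condDistrib_ae_eq_of_measure_eq_compProd (μ := P₁.prod P₂) (κ := κ)
    (fun ω : Ω₁ × Ω₂ => D ω.1) hS'.aemeasurable ?_
  · filter_upwards [ae_of_ae_map hD'.aemeasurable key] with ω hω
    rw [hω, hκ]
  · ext s hs
    have hfst : (P₁.prod P₂).map (fun ω => D ω.1) = P₁.map D := by
      rw [← Function.comp_def D Prod.fst, ← Measure.map_map hD measurable_fst,
        Measure.map_fst_prod]
      simp
    rw [Measure.compProd_apply hs, hfst, lintegral_map (Kernel.measurable_kernel_prodMk_left hs) hD,
      Measure.map_apply (hD'.prodMk hS') hs, Measure.prod_apply ((hD'.prodMk hS') hs)]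
    refine lintegral_congr fun ω₁ => ?_
    rw [hκ, Measure.map_apply (by fun_prop) (measurable_prodMk_left hs)]
    rfl

theorem measurable_data {Ω₁ : Type*} [MeasurableSpace Ω₁] {p : ℕ} {N : ℕ → Ω₁ → ℕ}
    {Z : ℕ → ℕ → Ω₁ → EuclideanSpace ℝ (Fin p)} (hN : ∀ n, Measurable (N n))
    (hZ : ∀ n l, Measurable (Z n l)) (n : ℕ) : Measurable (data N Z n) := by
  refine (hN n).prodMk (measurable_pi_lambda _ fun l => ?_)
  exact Measurable.ite (measurableSet_lt measurable_const (hN n)) (hZ n l) measurable_const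

/-- The conditional law of the multiplier sum is the law of the weighted sum of the multipliers
with the data frozen at their observed values. The sum only involves the `Z n l` with `l < N n`, so
it is a function of `data N Z n` and the multipliers. -/
theorem condLaw_ae_eq_map {Ω₁ Ω₂ : Type*} [MeasurableSpace Ω₁] [MeasurableSpace Ω₂]
    (P₁ : Measure Ω₁) (P₂ : Measure Ω₂) [IsProbabilityMeasure P₁] [IsProbabilityMeasure P₂]
    {p : ℕ} {N : ℕ → Ω₁ → ℕ} {Z : ℕ → ℕ → Ω₁ → EuclideanSpace ℝ (Fin p)} {G : ℕ → ℕ → Ω₂ → ℝ}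
    (hN : ∀ n, Measurable (N n)) (hZ : ∀ n l, Measurable (Z n l))
    (hG : ∀ n l, Measurable (G n l)) (n : ℕ) :
    ∀ᵐ ω ∂(P₁.prod P₂), condLaw P₁ P₂ N Z G n ω =
      P₂.map fun ω₂ => ∑ l ∈ Finset.range (N n ω.1), G n l ω₂ • Z n l ω.1 := by
  let S : (ℕ × (ℕ → EuclideanSpace ℝ (Fin p))) × Ω₂ → EuclideanSpace ℝ (Fin p) :=
    fun x => ∑ l ∈ Finset.range x.1.1, G n l x.2 • x.1.2 l
  have hS : Measurable S := by
    -- on each slice with a fixed number of summands the sum has a constant index set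
    have : Measurable fun y : ℕ × ((ℕ → EuclideanSpace ℝ (Fin p)) × Ω₂) =>
        ∑ l ∈ Finset.range y.1, G n l y.2.2 • y.2.1 l :=
      measurable_from_prod_countable_right fun m => by dsimp only; fun_prop
    exact this.comp (g := fun y : ℕ × ((ℕ → EuclideanSpace ℝ (Fin p)) × Ω₂) =>
        ∑ l ∈ Finset.range y.1, G n l y.2.2 • y.2.1 l)
      (f := fun x : (ℕ × (ℕ → EuclideanSpace ℝ (Fin p))) × Ω₂ => (x.1.1, x.1.2, x.2))
      (by fun_prop)
  have hSD : ∀ ω₁ ω₂, S (data N Z n ω₁, ω₂) =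
      ∑ l ∈ Finset.range (N n ω₁), G n l ω₂ • Z n l ω₁ := fun ω₁ ω₂ =>
    Finset.sum_congr rfl fun l hl => by simp [data, Finset.mem_range.1 hl]
  have h := condDistrib_prod_ae_eq_map P₁ P₂ (measurable_data hN hZ n) hS
  simp only [hSD] at h
  exact h

end WildBootstrap

/-! ### Convergence in probability of the conditional law -/

theorem theorem5 {Ω₁ Ω₂ : Type*} [MeasurableSpace Ω₁] [MeasurableSpace Ω₂]
    (P₁ : Measure Ω₁) (P₂ : Measure Ω₂) [IsProbabilityMeasure P₁] [IsProbabilityMeasure P₂]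
    (p : ℕ)
    (N : ℕ → Ω₁ → ℕ) (Z : ℕ → ℕ → Ω₁ → EuclideanSpace ℝ (Fin p)) (G : ℕ → ℕ → Ω₂ → ℝ)
    (Γ : Matrix (Fin p) (Fin p) ℝ)
    (hN_meas : ∀ n, Measurable (N n))
    (hZ_meas : ∀ n l, Measurable (Z n l))
    (hG_meas : ∀ n l, Measurable (G n l))
    -- `N` is non-decreasing in `n` and tends to infinity in probability
    (hN_mono : ∀ᵐ ω ∂P₁, Monotone fun n => N n ω)
    (hN_top : ∀ K : ℕ, Tendsto (fun n => P₁ {ω | N n ω ≤ K}) atTop (𝓝 0))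
    -- i.i.d. rows of multipliers with one common law, of mean `0` and variance `1`
    (hG_indep : ∀ n, iIndepFun (G n) P₂)
    (hG_ident : ∀ n l, IdentDistrib (G n l) (G 0 0) P₂ P₂)
    (hG_sq : MemLp (G 0 0) 2 P₂)
    (hG_mean : ∫ ω, G 0 0 ω ∂P₂ = 0)
    (hG_var : variance (G 0 0) P₂ = 1)
    -- the two convergences in probability
    (hZ_max : TendstoInMeasure P₁
      (fun n ω => (Finset.range (N n ω)).sup fun l => ‖Z n l ω‖₊) atTop (fun _ => (0 : ℝ≥0)))
    (hZ_cov : ∀ i j : Fin p, TendstoInMeasure P₁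
      (fun n ω => (∑ l ∈ Finset.range (N n ω), Matrix.vecMulVec (Z n l ω) (Z n l ω)) i j)
      atTop (fun _ => Γ i j))
    (hΓ : Γ.PosDef) :
    WildBootstrap.TendstoWeaklyInProbability (P₁.prod P₂)
      (WildBootstrap.condLaw P₁ P₂ N Z G) (multivariateGaussian 0 Γ) := by
  have hf0 : P₂[G 0 0] = 0 := hG_mean
  have hf1 : P₂[G 0 0 ^ 2] = 1 := by
    rw [← hG_var, variance_of_integral_eq_zero hG_sq.aemeasurable hG_mean]
    rfl
  intro f
  rw [tendstoInMeasure_iff_dist]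
  intro ε hε
  obtain ⟨δ, hδ, hclose⟩ := WildBootstrap.exists_forall_abs_integral_sum_smul_sub_lt hG_meas
    hG_indep hG_sq.aemeasurable hf0 hf1 (fun n l => (hG_ident n l).map_eq) hΓ.posSemidef f hε
  rw [tendstoInMeasure_iff_dist] at hZ_max
  simp_rw [tendstoInMeasure_iff_dist] at hZ_cov
  have hlim := (hZ_max δ hδ).add
    (tendsto_finsetSum Finset.univ fun i _ => tendsto_finsetSum Finset.univ fun j _ =>
      hZ_cov i j δ hδ)
  simp only [Finset.sum_const_zero, add_zero] at hlim
  refine tendsto_of_tendsto_of_tendsto_of_le_of_le tendsto_const_nhds hlim (fun _ => zero_le)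
    fun n => ?_
  -- the data outside `A ∪ ⋃ i, ⋃ j, B i j` satisfy the hypotheses of `hclose`
  set A : Set Ω₁ := {ω | δ ≤ dist ((Finset.range (N n ω)).sup fun l => ‖Z n l ω‖₊) 0} with hA
  set B : Fin p → Fin p → Set Ω₁ := fun i j => {ω | δ ≤ dist
    ((∑ l ∈ Finset.range (N n ω), Matrix.vecMulVec (Z n l ω) (Z n l ω)) i j) (Γ i j)} with hB
  calc (P₁.prod P₂) {ω | ε ≤ dist (∫ x, f x ∂(WildBootstrap.condLaw P₁ P₂ N Z G n ω))
          (∫ x, f x ∂(multivariateGaussian 0 Γ))}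
      ≤ (P₁.prod P₂) (Prod.fst ⁻¹' (A ∪ ⋃ i, ⋃ j, B i j)) := by
        refine measure_mono_ae ?_
        filter_upwards [WildBootstrap.condLaw_ae_eq_map P₁ P₂ hN_meas hZ_meas hG_meas n]
          with ω hω hbad
        by_contra hgood
        have hgood' : ω.1 ∉ A ∪ ⋃ i, ⋃ j, B i j := hgood
        simp only [Set.mem_union, Set.mem_iUnion, not_or, not_exists] at hgood'
        obtain ⟨h1, h2⟩ := hgood'
        have hmeas : Measurable fun ω₂ =>
            ∑ l ∈ Finset.range (N n ω.1), G n l ω₂ • Z n l ω.1 := by fun_prop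
        have hbad' : ε ≤ dist (∫ x, f x ∂(WildBootstrap.condLaw P₁ P₂ N Z G n ω))
          (∫ x, f x ∂(multivariateGaussian 0 Γ)) := hbad
        rw [hω, integral_map hmeas.aemeasurable f.continuous.aestronglyMeasurable] at hbad'
        refine absurd (hclose n (N n ω.1) (fun l => Z n l ω.1) (fun l hl => ?_)
          fun i j => ?_) (not_lt.2 hbad')
        · have hle : ‖Z n l ω.1‖₊ ≤ (Finset.range (N n ω.1)).sup fun l => ‖Z n l ω.1‖₊ :=
            Finset.le_sup (f := fun l => ‖Z n l ω.1‖₊) (Finset.mem_range.2 hl)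
          have hlt : dist ((Finset.range (N n ω.1)).sup fun l => ‖Z n l ω.1‖₊) 0 < δ :=
            not_le.1 h1
          rw [NNReal.dist_eq, NNReal.coe_zero, sub_zero, abs_of_nonneg (NNReal.coe_nonneg _)] at hlt
          exact lt_of_le_of_lt (NNReal.coe_le_coe.2 hle) hlt
        · exact not_le.1 (h2 i j)
    _ ≤ P₁ (A ∪ ⋃ i, ⋃ j, B i j) :=
        (Measure.le_map_apply measurable_fst.aemeasurable _).trans (by simp)
    _ ≤ P₁ A + ∑ i, ∑ j, P₁ (B i j) := by
        refine (measure_union_le _ _).trans ?_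
        gcongr
        refine (measure_iUnion_fintype_le _ _).trans ?_
        gcongr
        exact measure_iUnion_fintype_le _ _
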